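/- Let $d\ge 1$ and $n\ge 32d$ be integers, let $\mathbb S^d=\{x\in\mathbb R^{d+1}:\|x\|_2=1\}$, and let $\pi_d$ be the uniform distribution on $\mathbb S^d$, i.e. the $d$-dimensional Hausdorff measure on $\mathbb S^d$ normalized to a probability measure. For $x\in\mathbb S^d$ and $t\in[-1,1]$ let $C(x,t)=\{y\in\mathbb S^d:\langle x,y\rangle>t\}$, let $$\mathcal S_d=\{C(x,t)\cap C(y,s): x,y\in\mathbb S^d,\ s,t\in[-1,1]\}$$ be the family of spherical slices, and for a finite set $P\subseteq\mathbb S^d$ let $$\mathrm{disp}(P;d)=\sup\{\pi_d(B): B\in\mathcal S_d,\ B\cap P=\emptyset\}$$ be its spherical dispersion. Let $X_1,\dots,X_n$ be independent random points in $\mathbb S^d$, each with distribution $\pi_d$, and let $\mathcal P_n=\{X_1,\dots,X_n\}$. Then $\mathrm{disp}(\mathcal P_n;d)$ is an integrable random variable and $$\frac19\,\frac{\log n}{n}\ \le\ \mathbb E\big[\mathrm{disp}(\mathcal P_n;d)\big]\ \le\ \frac{64}{\log 2}\,\frac dn\,\log\!\Big(\frac{en}{32d}\Big),$$ where $\log$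 is the natural logarithm. -/

import Mathlib

open MeasureTheory ProbabilityTheory

noncomputable section

namespace SphericalDispersion

/-- The Euclidean unit sphere `𝕊^d ⊆ ℝ^{d+1}`. -/
abbrev Sph (d : ℕ) : Type :=
  Metric.sphere (0 : EuclideanSpace ℝ (Fin (d + 1))) 1

/-- The uniform distribution `π_d` on `𝕊^d`: the `d`-dimensional Hausdorff measure (for the
Euclidean metric), normalized to total mass one. -/
def uniformMeasure (d : ℕ) : Measure (Sph d) :=
  (Measure.hausdorffMeasure (d : ℝ) (Set.univ : Set (Sph d)))⁻¹ •
    Measure.hausdorffMeasure (d : ℝ)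

/-- The open spherical cap `C(x,t) = {y ∈ 𝕊^d : ⟨x,y⟩ > t}`. -/
def cap {d : ℕ} (x : Sph d) (t : ℝ) : Set (Sph d) :=
  {y | t < inner ℝ (x : EuclideanSpace ℝ (Fin (d + 1))) (y : EuclideanSpace ℝ (Fin (d + 1)))}

/-- The collection of spherical slices: intersections of two caps `C(x,t)`, `C(y,s)` with
`s, t ∈ [-1,1]`. -/
def slices (d : ℕ) : Set (Set (Sph d)) :=
  {B | ∃ x y : Sph d, ∃ t ∈ Set.Icc (-1 : ℝ) 1, ∃ s ∈ Set.Icc (-1 : ℝ) 1,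
    B = cap x t ∩ cap y s}

/-- The spherical dispersion of a point set: the supremum of the normalized surface measures of
the slices that contain no point of `P`. -/
def disp (d : ℕ) (P : Set (Sph d)) : ℝ :=
  sSup {r : ℝ | ∃ B ∈ slices d, P ∩ B = ∅ ∧ r = (uniformMeasure d).real B}

end SphericalDispersion

end

noncomputable section

namespace SphericalDispersion

/-! Upper bound. Slices cut at most `G` subsets out of any `2 n` points, with `log G` of order `d *
log (e n / (32 d))`. This is turned directly into an exponential moment. Draw a second sample `y`
and weight each pair by `pairWeight`: integrating the product over `y` gives `(1 + π B) ^ n` when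
`B` misses `x` and `0` otherwise, while averaging over swaps of the pairs gives at most `1` for each
`B`. Once the `2 n` points are fixed, only `G` different products occur, so the supremum over `B`
has expectation at most `G` (`lintegral_iSup_one_add_measure_pow_le`). As `2 ^ t ≤ 1 + t` on `[0,
1]`, this bounds the mean of `2 ^ (n * disp)`, and Jensen's inequality finishes. The growth bound
combines Radon's theorem, Sauer–Shelah and the fact that a slice is a meet of two caps.

Lower bound. Quantiles of one coordinate give `N` disjoint bands of measure `1 / N`, each a slice
(`exists_disjoint_slices`). With `N` about `2 n / log n`, a second-moment argument
(`le_integral_of_missed`) shows that some band is missed with probability at least `2 / 9`.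

Measurability of the supremum comes from a countable family of slices that approximates all others
from inside. -/

/-- The indices of the points of the finite family `z` lying in `B`. -/
def trace {α S : Type*} [Fintype α] (z : α → S) (B : Set S) : Finset α := by
  classical exact Finset.univ.filter fun j => z j ∈ B

@[simp] lemma mem_trace {α S : Type*} [Fintype α] {z : α → S} {B : Set S} {j : α} :
    j ∈ trace z B ↔ z j ∈ B := by
  simp [trace]

/-! ### Double sampling -/

section DoubleSampling

open scoped ENNReal Classical

variable {S : Type*}

/-- Weight of a pair of points relative to `B`: zero if the first point lies in `B`, and otherwise
two or one according to whether the second point lies in `B`. -/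
def pairWeight (B : Set S) (p : S × S) : ℝ≥0∞ :=
  if p.1 ∈ B then 0 else if p.2 ∈ B then 2 else 1

lemma measurable_pairWeight [MeasurableSpace S] {B : Set S} (hB : MeasurableSet B) :
    Measurable (pairWeight B) :=
  Measurable.ite (measurable_fst hB) measurable_const
    (Measurable.ite (measurable_snd hB) measurable_const measurable_const)

lemma pairWeight_add_swap_le (B : Set S) (p : S × S) :
    pairWeight B p + pairWeight B p.swap ≤ 2 := by
  unfold pairWeight
  by_cases h₁ : p.1 ∈ B <;> by_cases h₂ : p.2 ∈ B <;> simp [h₁, h₂, one_add_one_eq_two]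

/-- Swap the pairs of `z` marked by `σ`. -/
def swapBy {n : ℕ} (σ : Fin n → Bool) (z : Fin n → S × S) : Fin n → S × S :=
  fun i => if σ i then (z i).swap else z i

/-- Distributivity turns the sum over all swaps into a product over pairs of two-term sums, each at
most `2`. -/
lemma sum_prod_pairWeight_swapBy_le {n : ℕ} (B : Set S) (z : Fin n → S × S) :
    ∑ σ : Fin n → Bool, ∏ i, pairWeight B (swapBy σ z i) ≤ 2 ^ n := by
  have h := Finset.prod_univ_sum (fun _ : Fin n => (Finset.univ : Finset Bool))
    (fun i b => pairWeight B (if b then (z i).swap else z i))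
  simp only [Fintype.piFinset_univ] at h
  unfold swapBy
  rw [← h]
  calc _ ≤ ∏ _i : Fin n, (2 : ℝ≥0∞) := by
        refine Finset.prod_le_prod' fun i _ => ?_
        rw [Fintype.sum_bool, add_comm]
        simpa using pairWeight_add_swap_le B (z i)
    _ = 2 ^ n := by simp

/-- Both points of the pairs of `z`, as a single family. -/
def unpair {n : ℕ} (z : Fin n → S × S) : Fin n × Bool → S :=
  fun j => if j.2 then (z j.1).2 else (z j.1).1

lemma pairWeight_swapBy_congr {n : ℕ} {B B' : Set S} {z : Fin n → S × S}
    (h : trace (unpair z) B = trace (unpair z) B') (σ : Fin n → Bool) (i : Fin n) :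
    pairWeight B (swapBy σ z i) = pairWeight B' (swapBy σ z i) := by
  have h₁ : (z i).1 ∈ B ↔ (z i).1 ∈ B' := by
    simpa [unpair] using Finset.ext_iff.1 h (i, false)
  have h₂ : (z i).2 ∈ B ↔ (z i).2 ∈ B' := by
    simpa [unpair] using Finset.ext_iff.1 h (i, true)
  unfold pairWeight swapBy
  cases σ i <;> simp [h₁, h₂]

lemma sum_iSup_prod_pairWeight_le {n : ℕ} {ι : Type*} (B : ι → Set S) (z : Fin n → S × S)
    (𝒜 : Finset (Finset (Fin n × Bool))) (h𝒜 : ∀ k, trace (unpair z) (B k) ∈ 𝒜) :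
    ∑ σ : Fin n → Bool, ⨆ k, ∏ i, pairWeight (B k) (swapBy σ z i) ≤ (𝒜.card : ℝ≥0∞) * 2 ^ n := by
  let F : Finset (Fin n × Bool) → (Fin n → Bool) → ℝ≥0∞ := fun T σ =>
    if h : ∃ k, trace (unpair z) (B k) = T then
      ∏ i, pairWeight (B h.choose) (swapBy σ z i) else 0
  have hF : ∀ k σ, ∏ i, pairWeight (B k) (swapBy σ z i) = F (trace (unpair z) (B k)) σ := by
    intro k σ
    have h : ∃ l, trace (unpair z) (B l) = trace (unpair z) (B k) := ⟨k, rfl⟩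
    simp only [F, dif_pos h]
    exact Finset.prod_congr rfl fun i _ => pairWeight_swapBy_congr h.choose_spec.symm σ i
  calc ∑ σ : Fin n → Bool, ⨆ k, ∏ i, pairWeight (B k) (swapBy σ z i)
      ≤ ∑ σ : Fin n → Bool, ∑ T ∈ 𝒜, F T σ := by
        refine Finset.sum_le_sum fun σ _ => iSup_le fun k => ?_
        rw [hF]
        exact Finset.single_le_sum (f := fun T => F T σ) (fun _ _ => zero_le) (h𝒜 k)
    _ = ∑ T ∈ 𝒜, ∑ σ : Fin n → Bool, F T σ := Finset.sum_comm
    _ ≤ ∑ _T ∈ 𝒜, 2 ^ n := by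
        refine Finset.sum_le_sum fun T _ => ?_
        by_cases h : ∃ k, trace (unpair z) (B k) = T
        · simp only [F, dif_pos h]
          exact sum_prod_pairWeight_swapBy_le _ z
        · simp [F, dif_neg h]
    _ = _ := by simp

variable [MeasurableSpace S] (π : Measure S) [IsProbabilityMeasure π]

/-- For fixed `x` the factors are independent in `y`; a factor with `x i ∉ B` has mean `1 + π B`,
and any `x i ∈ B` kills the product. -/
lemma lintegral_prod_pairWeight {n : ℕ} {B : Set S} (hB : MeasurableSet B) (x : Fin n → S) :
    ∫⁻ y, ∏ i, pairWeight B (x i, y i) ∂(Measure.pi fun _ : Fin n => π) =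
      if ∀ i, x i ∉ B then (1 + π B) ^ n else 0 := by
  have hm : ∀ i, Measurable fun s => pairWeight B (x i, s) := fun i =>
    (measurable_pairWeight hB).comp measurable_prodMk_left
  have hind : iIndepFun (fun i (y : Fin n → S) => pairWeight B (x i, y i))
      (Measure.pi fun _ : Fin n => π) :=
    iIndepFun_pi (X := fun i s => pairWeight B (x i, s)) fun i => (hm i).aemeasurable
  rw [lintegral_prod_eq_prod_lintegral_of_indepFun _ _ hind
    fun i => (hm i).comp (measurable_pi_apply i)]
  have key : ∀ i, ∫⁻ y, pairWeight B (x i, y i) ∂(Measure.pi fun _ : Fin n => π) =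
      if x i ∈ B then 0 else 1 + π B := by
    intro i
    rw [(measurePreserving_eval (fun _ : Fin n => π) i).lintegral_comp (hm i)]
    by_cases h : x i ∈ B
    · simp [pairWeight, h]
    · have : ∀ s, pairWeight B (x i, s) = 1 + B.indicator 1 s := by
        intro s
        by_cases hs : s ∈ B <;> simp [pairWeight, h, hs, one_add_one_eq_two]
      simp_rw [this]
      rw [lintegral_add_left measurable_const, lintegral_indicator_one hB]
      simp [h]
  simp_rw [key]
  split_ifs with h
  · simp [h]
  · push Not at h
    obtain ⟨i, hi⟩ := h
    exact Finset.prod_eq_zero (Finset.mem_univ i) (by simp [hi])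

lemma measurePreserving_swapBy {n : ℕ} (σ : Fin n → Bool) :
    MeasurePreserving (swapBy (S := S) σ) (Measure.pi fun _ : Fin n => π.prod π)
      (Measure.pi fun _ : Fin n => π.prod π) := by
  refine measurePreserving_pi (fun _ : Fin n => π.prod π) (fun _ => π.prod π)
    (f := fun i p => if σ i then p.swap else p) fun i => ?_
  cases σ i
  · exact MeasurePreserving.id (π.prod π)
  · simpa using Measure.measurePreserving_swap (μ := π) (ν := π)

/-- If a countable family of measurable sets cuts out at most `G` subsets of any `2 n` points, then
the largest value of `(1 + π B) ^ n` over the members `B` of the family missed by `n` independent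
points of law `π` has expectation at most `G`. -/
theorem lintegral_iSup_one_add_measure_pow_le {n : ℕ} {ι : Type*} [Countable ι] (B : ι → Set S)
    (hB : ∀ k, MeasurableSet (B k)) (G : ℕ)
    (hG : ∀ z : Fin n × Bool → S, ∃ 𝒜 : Finset (Finset (Fin n × Bool)),
      𝒜.card ≤ G ∧ ∀ k, trace z (B k) ∈ 𝒜) :
    ∫⁻ x, ⨆ k, (if ∀ i, x i ∉ B k then (1 + π (B k)) ^ n else 0)
      ∂(Measure.pi fun _ : Fin n => π) ≤ G := by
  let F : (Fin n → S × S) → ℝ≥0∞ := fun z => ⨆ k, ∏ i, pairWeight (B k) (z i)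
  have hF : Measurable F := Measurable.iSup fun k => Finset.measurable_prod _ fun i _ =>
    (measurable_pairWeight (hB k)).comp (measurable_pi_apply i)
  let e := MeasurableEquiv.arrowProdEquivProdArrow S S (Fin n)
  have he := measurePreserving_arrowProdEquivProdArrow S S (Fin n) (fun _ => π) (fun _ => π)
  have hswap : ∀ σ : Fin n → Bool,
      ∫⁻ z, F (swapBy σ z) ∂(Measure.pi fun _ : Fin n => π.prod π) =
        ∫⁻ z, F z ∂(Measure.pi fun _ : Fin n => π.prod π) := fun σ =>
    (measurePreserving_swapBy π σ).lintegral_comp hF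
  have hsum : (2 : ℝ≥0∞) ^ n * ∫⁻ z, F z ∂(Measure.pi fun _ : Fin n => π.prod π) ≤
      2 ^ n * G := by
    calc (2 : ℝ≥0∞) ^ n * ∫⁻ z, F z ∂(Measure.pi fun _ : Fin n => π.prod π)
        = ∑ σ : Fin n → Bool,
            ∫⁻ z, F (swapBy σ z) ∂(Measure.pi fun _ : Fin n => π.prod π) := by
          simp [hswap]
      _ = ∫⁻ z, ∑ σ : Fin n → Bool, F (swapBy σ z) ∂(Measure.pi fun _ : Fin n => π.prod π) :=
          (lintegral_finsetSum _ fun σ _ => hF.comp (measurePreserving_swapBy π σ).measurable).symm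
      _ ≤ ∫⁻ _z, (G : ℝ≥0∞) * 2 ^ n ∂(Measure.pi fun _ : Fin n => π.prod π) := by
          refine lintegral_mono fun z => ?_
          obtain ⟨𝒜, hc, h𝒜⟩ := hG (unpair z)
          refine (sum_iSup_prod_pairWeight_le B z 𝒜 h𝒜).trans ?_
          gcongr
      _ = 2 ^ n * G := by simp [mul_comm]
  have hFG : ∫⁻ z, F z ∂(Measure.pi fun _ : Fin n => π.prod π) ≤ G :=
    (ENNReal.mul_le_mul_iff_right (by simp) (by finiteness)).1 hsum
  calc ∫⁻ x, ⨆ k, (if ∀ i, x i ∉ B k then (1 + π (B k)) ^ n else 0)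
        ∂(Measure.pi fun _ : Fin n => π)
      = ∫⁻ x, ⨆ k, ∫⁻ y, ∏ i, pairWeight (B k) (x i, y i)
          ∂(Measure.pi fun _ : Fin n => π) ∂(Measure.pi fun _ : Fin n => π) := by
        simp_rw [lintegral_prod_pairWeight π (hB _)]
    _ ≤ ∫⁻ x, ∫⁻ y, F (e.symm (x, y))
          ∂(Measure.pi fun _ : Fin n => π) ∂(Measure.pi fun _ : Fin n => π) := by
        refine lintegral_mono fun x => iSup_le fun k => lintegral_mono fun y => ?_
        exact le_iSup (fun k => ∏ i, pairWeight (B k) (x i, y i)) k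
    _ = ∫⁻ p, F (e.symm p)
          ∂((Measure.pi fun _ : Fin n => π).prod (Measure.pi fun _ : Fin n => π)) :=
        (lintegral_prod _ (hF.comp e.symm.measurable).aemeasurable).symm
    _ = ∫⁻ z, F z ∂(Measure.pi fun _ : Fin n => π.prod π) := (he.symm e).lintegral_comp hF
    _ ≤ G := hFG

end DoubleSampling

/-! ### Growth of the family of slices -/

/-- No set of more than `d + 2` points is shattered by caps. -/
lemma card_le_of_shatters_cap {α : Type*} [Fintype α] [DecidableEq α] {d : ℕ} (z : α → Sph d)
    (𝒜 : Finset (Finset α)) (h𝒜 : ∀ T ∈ 𝒜, ∃ x t, T = trace z (cap x t)) {s : Finset α}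
    (hs : 𝒜.Shatters s) : s.card ≤ d + 2 := by
  classical
  by_contra! hcard
  let f : s → EuclideanSpace ℝ (Fin (d + 1)) := fun j => z j
  have hf : ¬ AffineIndependent ℝ f := by
    -- Affinely independent points of a `(d + 1)`-dimensional space number at most `d + 2`.
    intro hf
    have h₁ := hf.card_le_finrank_succ
    have h₂ := Submodule.finrank_le (vectorSpan ℝ (Set.range f))
    rw [finrank_euclideanSpace_fin] at h₂
    rw [Fintype.card_coe] at h₁
    omega
  obtain ⟨I, p, hp₁, hp₂⟩ := Convex.radon_partition hf
  -- Shattering supplies a cap that picks exactly one Radon class; the common point `p` would then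
  -- lie on both sides of its hyperplane.
  obtain ⟨T, hT, hsT⟩ := hs (t := s.filter fun j => ∃ h : j ∈ s, (⟨j, h⟩ : s) ∈ I)
    (Finset.filter_subset _ _)
  obtain ⟨x, t, rfl⟩ := h𝒜 T hT
  have hmem : ∀ j : s, z j ∈ cap x t ↔ j ∈ I := by
    intro j
    have := Finset.ext_iff.1 hsT j
    simpa using this
  let g : EuclideanSpace ℝ (Fin (d + 1)) →ₗ[ℝ] ℝ := innerₛₗ ℝ (x : EuclideanSpace ℝ (Fin (d + 1)))
  have h₁ : t < g p := by
    have : convexHull ℝ (f '' I) ⊆ {w | t < g w} := by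
      refine convexHull_min ?_ (convex_halfSpace_gt g.isLinear t)
      rintro _ ⟨j, hj, rfl⟩
      exact (hmem j).2 hj
    exact this hp₁
  have h₂ : g p ≤ t := by
    have : convexHull ℝ (f '' Iᶜ) ⊆ {w | g w ≤ t} := by
      refine convexHull_min ?_ (convex_halfSpace_le g.isLinear t)
      rintro _ ⟨j, hj, rfl⟩
      have h : ¬ t < g (f j) := fun h => hj ((hmem j).1 h)
      exact not_lt.1 h
    exact this hp₂
  exact absurd h₁ (not_lt.2 h₂)

open Classical in
lemma exists_finset_trace_cap {α : Type*} [Fintype α] {d : ℕ} (z : α → Sph d) :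
    ∃ 𝒜 : Finset (Finset α), 𝒜.card ≤ ∑ i ∈ Finset.Iic (d + 2), (Fintype.card α).choose i ∧
      ∀ x t, trace z (cap x t) ∈ 𝒜 := by
  let 𝒜 : Finset (Finset α) := Finset.univ.filter fun T => ∃ x t, T = trace z (cap x t)
  have hdim : 𝒜.vcDim ≤ d + 2 := Finset.sup_le fun s hs =>
    card_le_of_shatters_cap z 𝒜 (fun T hT => by simpa [𝒜] using hT) (Finset.mem_shatterer.1 hs)
  refine ⟨𝒜, ?_, fun x t => by simp only [𝒜, Finset.mem_filter_univ]; exact ⟨x, t, rfl⟩⟩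
  refine (𝒜.card_le_card_shatterer.trans Finset.card_shatterer_le_sum_vcDim).trans ?_
  exact Finset.sum_le_sum_of_subset (Finset.Iic_subset_Iic.2 hdim)

open Classical in
lemma exists_finset_trace_slices {α : Type*} [Fintype α] {d : ℕ} (z : α → Sph d) :
    ∃ 𝒜 : Finset (Finset α),
      𝒜.card ≤ (∑ i ∈ Finset.Iic (d + 2), (Fintype.card α).choose i) ^ 2 ∧
      ∀ B ∈ slices d, trace z B ∈ 𝒜 := by
  obtain ⟨𝒜, hc, h⟩ := exists_finset_trace_cap z
  refine ⟨Finset.image₂ (· ∩ ·) 𝒜 𝒜, ?_, ?_⟩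
  · rw [sq]
    exact (Finset.card_image₂_le _ _ _).trans (Nat.mul_le_mul hc hc)
  · rintro _ ⟨x, y, t, -, s, -, rfl⟩
    refine Finset.mem_image₂.2 ⟨_, h x t, _, h y s, ?_⟩
    ext j
    simp

lemma sum_choose_le {m D : ℕ} {x : ℝ} (hx : 0 < x) (hx1 : x ≤ 1) :
    (∑ i ∈ Finset.Iic D, (m.choose i : ℝ)) * x ^ D ≤ Real.exp (m * x) := by
  calc (∑ i ∈ Finset.Iic D, (m.choose i : ℝ)) * x ^ D
      ≤ ∑ i ∈ Finset.Iic D, (m.choose i : ℝ) * x ^ i := by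
        rw [Finset.sum_mul]
        refine Finset.sum_le_sum fun i hi => ?_
        have := pow_le_pow_of_le_one hx.le hx1 (Finset.mem_Iic.1 hi)
        gcongr
    -- An index range containing both `Iic D` and `range (m + 1)`; the terms beyond `m` vanish.
    _ ≤ ∑ i ∈ Finset.range (m + D + 1), (m.choose i : ℝ) * x ^ i := by
        refine Finset.sum_le_sum_of_subset_of_nonneg (fun i hi => ?_) fun i _ _ => by positivity
        have := Finset.mem_Iic.1 hi
        exact Finset.mem_range.2 (by omega)
    _ = ∑ i ∈ Finset.range (m + 1), (m.choose i : ℝ) * x ^ i := by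
        refine (Finset.sum_subset (fun i hi => ?_) fun i _ hi => ?_).symm
        · have := Finset.mem_range.1 hi
          exact Finset.mem_range.2 (by omega)
        · rw [Finset.mem_range, not_lt] at hi
          rw [Nat.choose_eq_zero_of_lt (by omega)]
          simp
    _ = (x + 1) ^ m := by
        rw [add_pow]
        exact Finset.sum_congr rfl fun i _ => by ring
    _ ≤ Real.exp x ^ m := by
        gcongr
        exact Real.add_one_le_exp x
    _ = Real.exp (m * x) := (Real.exp_nat_mul x m).symm

/-- A logarithmic bound for the growth function of slices at `2 n` points. -/
lemma log_sq_sum_choose_le {n d : ℕ} (hd : 1 ≤ d) (hn : 32 * d ≤ n) :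
    Real.log (((∑ i ∈ Finset.Iic (d + 2), (2 * n).choose i) ^ 2 : ℕ) : ℝ) ≤
      64 * d * Real.log (Real.exp 1 * n / (32 * d)) := by
  have hd' : (1 : ℝ) ≤ d := by exact_mod_cast hd
  have hn' : 32 * (d : ℝ) ≤ n := by exact_mod_cast hn
  have hn0 : (0 : ℝ) < n := by linarith
  -- The choice `x = 4 d / n` makes the exponential factor `exp (2 n x) = exp (8 d)`.
  have hx : 0 < 4 * (d : ℝ) / n := by positivity
  have hx1 : 4 * (d : ℝ) / n ≤ 1 := by rw [div_le_one hn0]; linarith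
  have h := sum_choose_le (m := 2 * n) (D := d + 2) hx hx1
  set A : ℝ := ∑ i ∈ Finset.Iic (d + 2), ((2 * n).choose i : ℝ) with hA
  have hApos : 0 < A := by
    refine Finset.sum_pos' (fun i _ => by positivity) ⟨0, by simp, by simp⟩
  set L := Real.log (n / (32 * d)) with hL
  have hL0 : 0 ≤ L := Real.log_nonneg (by rw [le_div_iff₀ (by positivity)]; linarith)
  have hlogx : Real.log (4 * d / n) = -(3 * Real.log 2 + L) := by
    have : 4 * (d : ℝ) / n = (2 ^ 3 * ((n : ℝ) / (32 * d)))⁻¹ := by field_simp; norm_num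
    rw [this, Real.log_inv, Real.log_mul (by norm_num) (by positivity), Real.log_pow]
    norm_num [hL]
  have hlog : Real.log A ≤ 8 * d + (d + 2) * (3 * Real.log 2 + L) := by
    have h1 := Real.log_le_log (by positivity) h
    rw [Real.log_exp, Real.log_mul hApos.ne' (by positivity), Real.log_pow, hlogx] at h1
    push_cast at h1
    have : 2 * (n : ℝ) * (4 * d / n) = 8 * d := by field_simp; norm_num
    linarith
  have hrhs : Real.log (Real.exp 1 * n / (32 * d)) = 1 + L := by
    rw [mul_div_assoc, Real.log_mul (Real.exp_pos 1).ne' (by positivity), Real.log_exp]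
  have h2 : Real.log 2 ≤ 1 := by linarith [Real.log_two_lt_d9]
  rw [hrhs]
  push_cast
  rw [← hA, Real.log_pow]
  push_cast
  have h3 : ((d : ℝ) + 2) * (3 * Real.log 2 + L) ≤ 3 * d * (3 + L) := by
    gcongr <;> linarith
  nlinarith [mul_nonneg (zero_le_one.trans hd') hL0]

section

/-! ### Elementary properties of the dispersion -/

lemma isOpen_cap {d : ℕ} (x : Sph d) (t : ℝ) : IsOpen (cap x t) :=
  isOpen_lt continuous_const (continuous_const.inner continuous_subtype_val)

lemma measurableSet_of_mem_slices {d : ℕ} {B : Set (Sph d)} (hB : B ∈ slices d) :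
    MeasurableSet B := by
  obtain ⟨x, y, t, -, s, -, rfl⟩ := hB
  exact ((isOpen_cap x t).inter (isOpen_cap y s)).measurableSet

lemma inner_le_one {d : ℕ} (x y : Sph d) :
    inner ℝ (x : EuclideanSpace ℝ (Fin (d + 1))) (y : EuclideanSpace ℝ (Fin (d + 1))) ≤ 1 := by
  have h := real_inner_le_norm (x : EuclideanSpace ℝ (Fin (d + 1))) y
  rwa [norm_eq_of_mem_sphere, norm_eq_of_mem_sphere, one_mul] at h

lemma empty_mem_slices {d : ℕ} (x : Sph d) : ∅ ∈ slices d := by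
  refine ⟨x, x, 1, by simp, 1, by simp, ?_⟩
  ext y
  simp [cap, inner_le_one]

lemma disp_nonneg {d : ℕ} (P : Set (Sph d)) : 0 ≤ disp d P := by
  refine Real.sSup_nonneg ?_
  rintro _ ⟨B, -, -, rfl⟩
  exact measureReal_nonneg

lemma range_inter_eq_empty_iff {n d : ℕ} {x : Fin n → Sph d} {B : Set (Sph d)} :
    Set.range x ∩ B = ∅ ↔ ∀ i, x i ∉ B := by
  rw [← Set.disjoint_iff_inter_eq_empty, Set.disjoint_left, Set.forall_mem_range]

/-- Centres run through a dense sequence and thresholds through the rationals, clamped to `[-1, 1]`.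
Moving the centre by less than `δ` changes inner products by less than `δ`, so a threshold between
`t + δ` and `t + 2 δ` keeps the cap inside `cap x t`, and every point of `cap x t` is captured as `δ
→ 0`. -/
lemma exists_countable_caps {d : ℕ} [Nonempty (Sph d)] : ∃ C : ℕ × ℚ → Set (Sph d),
    (∀ k, ∃ x, ∃ t ∈ Set.Icc (-1 : ℝ) 1, C k = cap x t) ∧
    ∀ x, ∀ t ∈ Set.Icc (-1 : ℝ) 1, ∃ u : ℕ → ℕ × ℚ, (∀ m, C (u m) ⊆ cap x t) ∧
      ∀ y ∈ cap x t, ∀ᶠ m in Filter.atTop, y ∈ C (u m) := by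
  let z := TopologicalSpace.denseSeq (Sph d)
  refine ⟨fun k => cap (z k.1) (max (-1) (min 1 (k.2 : ℝ))), fun k => ⟨_, _, ?_, rfl⟩, ?_⟩
  · simp
  intro x t ht
  have hδ : ∀ m : ℕ, (0 : ℝ) < 1 / (m + 1) := fun m => Nat.one_div_pos_of_nat
  have hz : ∀ m : ℕ, ∃ i, dist x (z i) < 1 / (m + 1) := fun m =>
    (TopologicalSpace.denseRange_denseSeq (Sph d)).exists_dist_lt x (hδ m)
  have hq : ∀ m : ℕ, ∃ q : ℚ, t + 1 / (m + 1) < q ∧ (q : ℝ) < t + 2 * (1 / (m + 1)) := fun m =>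
    exists_rat_btwn (by linarith [hδ m])
  choose i hi using hz
  choose q hq₁ hq₂ using hq
  have hinner : ∀ m (y : Sph d),
      |inner ℝ (x : EuclideanSpace ℝ (Fin (d + 1))) (y : EuclideanSpace ℝ (Fin (d + 1))) -
        inner ℝ (z (i m) : EuclideanSpace ℝ (Fin (d + 1))) (y : EuclideanSpace ℝ (Fin (d + 1)))|
        < 1 / (m + 1) := by
    intro m y
    rw [← inner_sub_left]
    refine (abs_real_inner_le_norm _ _).trans_lt ?_
    rw [norm_eq_of_mem_sphere y, mul_one, ← dist_eq_norm]
    exact hi m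
  refine ⟨fun m => (i m, q m), fun m y hy => ?_, fun y hy => ?_⟩
  · simp only [cap, Set.mem_ofPred_eq] at hy ⊢
    have h₁ := inner_le_one (z (i m)) y
    have h₂ := (abs_lt.1 (hinner m y)).1
    have h₃ := (le_max_right _ _).trans_lt hy
    -- If the threshold was clamped to `1`, the approximating cap is empty.
    rcases min_lt_iff.1 h₃ with h | h
    · linarith
    · linarith [hq₁ m]
  · simp only [cap, Set.mem_ofPred_eq] at hy ⊢
    have hlim := tendsto_one_div_add_atTop_nhds_zero_nat (𝕜 := ℝ)
    filter_upwards [hlim.eventually_lt_const (show (0 : ℝ) < (inner ℝ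
      (x : EuclideanSpace ℝ (Fin (d + 1))) (y : EuclideanSpace ℝ (Fin (d + 1))) - t) / 3 by
        linarith)] with m hm
    have h₂ := (abs_lt.1 (hinner m y)).2
    have h₃ := hδ m
    refine max_lt ?_ (min_lt_of_right_lt ?_)
    · linarith [ht.1]
    · linarith [hq₂ m]

lemma measurableSet_forall_notMem {S : Type*} [MeasurableSpace S] {n : ℕ} {B : Set S}
    (hB : MeasurableSet B) : MeasurableSet {x : Fin n → S | ∀ i, x i ∉ B} := by
  rw [Set.ofPred_forall]
  exact MeasurableSet.iInter fun i => (measurable_pi_apply i hB).compl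

variable {d : ℕ} [IsProbabilityMeasure (uniformMeasure d)]

lemma bddAbove_disp (P : Set (Sph d)) :
    BddAbove {r : ℝ | ∃ B ∈ slices d, P ∩ B = ∅ ∧ r = (uniformMeasure d).real B} := by
  refine ⟨1, ?_⟩
  rintro _ ⟨B, -, -, rfl⟩
  exact measureReal_le_one

lemma measureReal_le_disp {P B : Set (Sph d)} (hB : B ∈ slices d) (hP : P ∩ B = ∅) :
    (uniformMeasure d).real B ≤ disp d P :=
  le_csSup (bddAbove_disp P) ⟨B, hB, hP, rfl⟩

lemma disp_le_one (P : Set (Sph d)) : disp d P ≤ 1 := by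
  refine Real.sSup_le ?_ zero_le_one
  rintro _ ⟨B, -, -, rfl⟩
  exact measureReal_le_one

/-! ### A countable family of slices -/

/-- Slices can be approximated in measure from the inside by a countable family of slices. -/
lemma exists_countable_slices : ∃ B : (ℕ × ℚ) × (ℕ × ℚ) → Set (Sph d), (∀ k, B k ∈ slices d) ∧
    ∀ A ∈ slices d, ∀ ε > 0, ∃ k, B k ⊆ A ∧
      (uniformMeasure d).real A - ε < (uniformMeasure d).real (B k) := by
  have : Nonempty (Sph d) := nonempty_of_isProbabilityMeasure (uniformMeasure d)
  obtain ⟨C, hC, happ⟩ := exists_countable_caps (d := d)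
  have hmem : ∀ k : (ℕ × ℚ) × (ℕ × ℚ), C k.1 ∩ C k.2 ∈ slices d := by
    intro k
    obtain ⟨x, t, ht, h₁⟩ := hC k.1
    obtain ⟨y, s, hs, h₂⟩ := hC k.2
    exact ⟨x, y, t, ht, s, hs, by rw [h₁, h₂]⟩
  refine ⟨fun k => C k.1 ∩ C k.2, hmem, ?_⟩
  rintro _ ⟨x, y, t, ht, s, hs, rfl⟩ ε hε
  obtain ⟨u, hu, hu'⟩ := happ x t ht
  obtain ⟨v, hv, hv'⟩ := happ y s hs
  have hlim := tendsto_measure_of_tendsto_indicator_of_isFiniteMeasure Filter.atTop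
    (uniformMeasure d) (As := fun m => C (u m) ∩ C (v m)) (A := cap x t ∩ cap y s)
    (fun m => measurableSet_of_mem_slices (hmem (u m, v m))) fun w => by
      by_cases hw : w ∈ cap x t ∩ cap y s
      · filter_upwards [hu' w hw.1, hv' w hw.2] with m h₁ h₂
        exact ⟨fun _ => hw, fun _ => ⟨h₁, h₂⟩⟩
      · exact .of_forall fun m => ⟨fun h => ⟨hu m h.1, hv m h.2⟩, fun h => absurd h hw⟩
  have hlim' := (ENNReal.tendsto_toReal (measure_ne_top _ _)).comp hlim
  obtain ⟨m, hm⟩ := (hlim'.eventually_const_lt (sub_lt_self _ hε)).exists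
  exact ⟨(u m, v m), Set.inter_subset_inter (hu m) (hv m), hm⟩

lemma exists_lt_measureReal_of_countable {ι : Type*} {B : ι → Set (Sph d)}
    (hB : ∀ A ∈ slices d, ∀ ε > 0, ∃ k, B k ⊆ A ∧
      (uniformMeasure d).real A - ε < (uniformMeasure d).real (B k))
    {n : ℕ} (x : Fin n → Sph d) {ε : ℝ} (hε : 0 < ε) :
    ∃ k, (∀ i, x i ∉ B k) ∧ disp d (Set.range x) - ε < (uniformMeasure d).real (B k) := by
  obtain ⟨y⟩ : Nonempty (Sph d) := nonempty_of_isProbabilityMeasure (uniformMeasure d)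
  have hne : {r : ℝ | ∃ B ∈ slices d, Set.range x ∩ B = ∅ ∧
      r = (uniformMeasure d).real B}.Nonempty := ⟨_, ∅, empty_mem_slices y, by simp, rfl⟩
  obtain ⟨_, ⟨A, hA, hxA, rfl⟩, hlt⟩ := exists_lt_of_lt_csSup hne
    (sub_lt_self (disp d (Set.range x)) (half_pos hε))
  obtain ⟨k, hk, hlt'⟩ := hB A hA (ε / 2) (half_pos hε)
  exact ⟨k, fun i hi => range_inter_eq_empty_iff.1 hxA i (hk hi), by linarith⟩

-- Reduces measurability of the dispersion to a countable supremum; the value `0` for slices that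
-- are hit is harmless because the dispersion is nonnegative.
open Classical in
lemma disp_range_eq_iSup {ι : Type*} {B : ι → Set (Sph d)} (hBs : ∀ k, B k ∈ slices d)
    (hB : ∀ A ∈ slices d, ∀ ε > 0, ∃ k, B k ⊆ A ∧
      (uniformMeasure d).real A - ε < (uniformMeasure d).real (B k))
    {n : ℕ} (x : Fin n → Sph d) :
    disp d (Set.range x) = ⨆ k, if ∀ i, x i ∉ B k then (uniformMeasure d).real (B k) else 0 := by
  have hle : ∀ k, (if ∀ i, x i ∉ B k then (uniformMeasure d).real (B k) else 0) ≤
      disp d (Set.range x) := by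
    intro k
    split_ifs with h
    · exact measureReal_le_disp (hBs k) (range_inter_eq_empty_iff.2 h)
    · exact disp_nonneg _
  refine le_antisymm (le_of_forall_pos_le_add fun ε hε => ?_) (Real.iSup_le hle (disp_nonneg _))
  obtain ⟨k, hk, hlt⟩ := exists_lt_measureReal_of_countable hB x hε
  have h := le_ciSup (f := fun k => if ∀ i, x i ∉ B k then (uniformMeasure d).real (B k) else 0)
    ⟨disp d (Set.range x), Set.forall_mem_range.2 hle⟩ k
  simp only [if_pos hk] at h
  linarith

lemma measurable_disp_range (n : ℕ) :
    Measurable fun x : Fin n → Sph d => disp d (Set.range x) := by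
  classical
  obtain ⟨B, hBs, hB⟩ := exists_countable_slices (d := d)
  simp_rw [disp_range_eq_iSup hBs hB]
  exact Measurable.iSup fun k => Measurable.ite
    (measurableSet_forall_notMem (measurableSet_of_mem_slices (hBs k)))
    measurable_const measurable_const

lemma integrable_disp_range {n : ℕ} (ρ : Measure (Fin n → Sph d)) [IsFiniteMeasure ρ] :
    Integrable (fun x : Fin n → Sph d => disp d (Set.range x)) ρ := by
  refine Integrable.of_bound (measurable_disp_range n).aestronglyMeasurable 1
    (.of_forall fun x => ?_)
  rw [Real.norm_eq_abs, abs_of_nonneg (disp_nonneg _)]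
  exact disp_le_one _

/-! ### The upper bound -/

/-- On `[0, log 2]` the convex exponential lies below its chord. -/
lemma exp_log_two_mul_le {t : ℝ} (h₀ : 0 ≤ t) (h₁ : t ≤ 1) : Real.exp (Real.log 2 * t) ≤ 1 + t := by
  have h := convexOn_exp.2 (Set.mem_univ 0) (Set.mem_univ (Real.log 2)) (sub_nonneg.2 h₁) h₀
    (by ring)
  simp only [smul_eq_mul, mul_zero, zero_add, Real.exp_zero,
    Real.exp_log (show (0 : ℝ) < 2 by norm_num)] at h
  rw [mul_comm]
  linarith

lemma lintegral_exp_disp_le (n : ℕ) :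
    ∫⁻ x : Fin n → Sph d, ENNReal.ofReal (Real.exp (n * (Real.log 2 * disp d (Set.range x))))
      ∂(Measure.pi fun _ => uniformMeasure d) ≤
      (((∑ i ∈ Finset.Iic (d + 2), (2 * n).choose i) ^ 2 : ℕ) : ENNReal) := by
  classical
  obtain ⟨B, hBs, hB⟩ := exists_countable_slices (d := d)
  refine le_trans (lintegral_mono fun x => ?_)
    (lintegral_iSup_one_add_measure_pow_le (uniformMeasure d) B
      (fun k => measurableSet_of_mem_slices (hBs k)) _ fun z => ?_)
  -- The countable family attains the dispersion only up to `ε`, so the bound is proved for `disp -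
  -- ε` and passed to the limit.
  · have hlim : Filter.Tendsto (fun ε : ℝ => ENNReal.ofReal
        (Real.exp (n * (Real.log 2 * (disp d (Set.range x) - ε))))) (nhdsWithin 0 (Set.Ioi 0))
        (nhds (ENNReal.ofReal (Real.exp (n * (Real.log 2 * disp d (Set.range x)))))) := by
      have : Continuous fun ε : ℝ => ENNReal.ofReal
        (Real.exp (n * (Real.log 2 * (disp d (Set.range x) - ε)))) :=
        ENNReal.continuous_ofReal.comp (by fun_prop)
      simpa using (this.tendsto 0).mono_left nhdsWithin_le_nhds
    refine le_of_tendsto hlim ?_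
    filter_upwards [self_mem_nhdsWithin] with ε hε
    obtain ⟨k, hk, hlt⟩ := exists_lt_measureReal_of_countable hB x hε
    refine le_trans ?_ (le_iSup _ k)
    rw [if_pos hk, ← ofReal_measureReal, ← ENNReal.ofReal_one,
      ← ENNReal.ofReal_add zero_le_one measureReal_nonneg, ← ENNReal.ofReal_pow (by positivity)]
    refine ENNReal.ofReal_le_ofReal ?_
    rw [Real.exp_nat_mul]
    have hlog : 0 < Real.log 2 := Real.log_pos one_lt_two
    refine pow_le_pow_left₀ (Real.exp_pos _).le (le_trans ?_
      (exp_log_two_mul_le measureReal_nonneg measureReal_le_one)) n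
    gcongr
  · obtain ⟨𝒜, hc, h𝒜⟩ := exists_finset_trace_slices z
    refine ⟨𝒜, hc.trans_eq ?_, fun k => h𝒜 _ (hBs k)⟩
    simp [mul_comm]

theorem integral_disp_le {n : ℕ} (hd : 1 ≤ d) (hn : 32 * d ≤ n) :
    ∫ x : Fin n → Sph d, disp d (Set.range x) ∂(Measure.pi fun _ => uniformMeasure d) ≤
      64 / Real.log 2 * ((d : ℝ) / n) * Real.log (Real.exp 1 * n / (32 * d)) := by
  set ρ : Measure (Fin n → Sph d) := Measure.pi fun _ => uniformMeasure d
  set G : ℕ := (∑ i ∈ Finset.Iic (d + 2), (2 * n).choose i) ^ 2 with hG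
  have hn0 : (0 : ℝ) < n := by exact_mod_cast (by omega : 0 < n)
  have hlog : 0 < Real.log 2 := Real.log_pos one_lt_two
  have hmeas : Measurable fun x : Fin n → Sph d =>
      Real.exp (n * (Real.log 2 * disp d (Set.range x))) :=
    (((measurable_disp_range n).const_mul _).const_mul _).exp
  have h_integrable : Integrable (fun x : Fin n → Sph d =>
      Real.exp (n * (Real.log 2 * disp d (Set.range x)))) ρ := by
    refine Integrable.of_bound hmeas.aestronglyMeasurable (Real.exp (n * (Real.log 2 * 1)))
      (.of_forall fun x => ?_)
    rw [Real.norm_eq_abs, Real.abs_exp]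
    gcongr
    exact disp_le_one _
  have hexp : ∫ x, Real.exp (n * (Real.log 2 * disp d (Set.range x))) ∂ρ ≤ G := by
    rw [integral_eq_lintegral_of_nonneg_ae (.of_forall fun x => (Real.exp_pos _).le)
      hmeas.aestronglyMeasurable]
    exact ENNReal.toReal_le_of_le_ofReal (Nat.cast_nonneg _)
      ((lintegral_exp_disp_le n).trans_eq (ENNReal.ofReal_natCast G).symm)
  have hjensen := convexOn_exp.map_integral_le (μ := ρ) Real.continuous_exp.continuousOn
    isClosed_univ (.of_forall fun _ => Set.mem_univ _)
    (((integrable_disp_range ρ).const_mul (Real.log 2)).const_mul (n : ℝ)) h_integrable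
  rw [integral_const_mul, integral_const_mul] at hjensen
  have hle := hjensen.trans hexp
  have hfin := ((Real.le_log_iff_exp_le ((Real.exp_pos _).trans_le hle)).2 hle).trans
    (log_sq_sum_choose_le hd hn)
  have : 64 / Real.log 2 * ((d : ℝ) / n) * Real.log (Real.exp 1 * n / (32 * d)) =
      (64 * d * Real.log (Real.exp 1 * n / (32 * d))) / (n * Real.log 2) := by
    field_simp
  rw [this, le_div_iff₀ (by positivity)]
  linarith

end

/-! ### Bands of equal measure -/

/-- The section is contained in an isometric copy of a sphere in `ℝ ^ d`, where the `d`-dimensional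
Hausdorff measure is a Haar measure and spheres are null. -/
lemma hausdorffMeasure_coord_eq {d : ℕ} (hd : 1 ≤ d) (t : ℝ) :
    Measure.hausdorffMeasure (d : ℝ)
      {y : Sph d | (y : EuclideanSpace ℝ (Fin (d + 1))) 0 = t} = 0 := by
  let ψ : EuclideanSpace ℝ (Fin d) → EuclideanSpace ℝ (Fin (d + 1)) :=
    fun w => WithLp.toLp 2 (Fin.cons t w)
  have hψ : Isometry ψ := Isometry.of_dist_eq fun v w => by
    simp [ψ, EuclideanSpace.dist_eq, Fin.sum_univ_succ]
  have hsub : ((↑) : Sph d → EuclideanSpace ℝ (Fin (d + 1))) ''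
      {y : Sph d | (y : EuclideanSpace ℝ (Fin (d + 1))) 0 = t} ⊆
      ψ '' Metric.sphere 0 (√(1 - t ^ 2)) := by
    rintro _ ⟨y, hy, rfl⟩
    refine ⟨WithLp.toLp 2 (Fin.tail y.1), ?_, ?_⟩
    · have h : ‖(y : EuclideanSpace ℝ (Fin (d + 1)))‖ ^ 2 = 1 := by
        rw [norm_eq_of_mem_sphere, one_pow]
      rw [EuclideanSpace.real_norm_sq_eq, Fin.sum_univ_succ] at h
      rw [mem_sphere_zero_iff_norm, EuclideanSpace.norm_eq]
      congr 1
      simp only [Set.mem_ofPred_eq] at hy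
      rw [hy] at h
      simp only [Real.norm_eq_abs, sq_abs, Fin.tail]
      linarith
    · ext i
      simp only [Set.mem_ofPred_eq] at hy
      refine Fin.cases ?_ (fun i => ?_) i <;> simp [ψ, hy, Fin.tail]
  have : Nonempty (Fin d) := ⟨⟨0, hd⟩⟩
  have hzero : Measure.hausdorffMeasure (d : ℝ)
      (Metric.sphere (0 : EuclideanSpace ℝ (Fin d)) (√(1 - t ^ 2))) = 0 := by
    have : Measure.IsAddHaarMeasure
        (Measure.hausdorffMeasure (d : ℝ) : Measure (EuclideanSpace ℝ (Fin d))) := by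
      simpa using isAddHaarMeasure_hausdorffMeasure (E := EuclideanSpace ℝ (Fin d))
    exact Measure.addHaar_sphere _ _ _
  rw [← isometry_subtype_coe.hausdorffMeasure_image (Or.inl (Nat.cast_nonneg d))]
  refine measure_mono_null hsub ?_
  rw [hψ.hausdorffMeasure_image (Or.inl (Nat.cast_nonneg d)), hzero]

lemma uniformMeasure_coord_eq {d : ℕ} (hd : 1 ≤ d) (t : ℝ) :
    uniformMeasure d {y : Sph d | (y : EuclideanSpace ℝ (Fin (d + 1))) 0 = t} = 0 := by
  simp [uniformMeasure, hausdorffMeasure_coord_eq hd t]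

lemma continuous_cdf (ν : Measure ℝ) [IsProbabilityMeasure ν] (hν : ∀ t, ν {t} = 0) :
    Continuous (cdf ν) := by
  refine continuous_iff_continuousAt.2 fun t => ?_
  have hmono := monotone_cdf ν
  rw [hmono.continuousAt_iff_leftLim_eq_rightLim, (cdf ν).rightLim_eq]
  have h := (cdf ν).measure_singleton t
  rw [measure_cdf, hν, eq_comm, ENNReal.ofReal_eq_zero] at h
  exact le_antisymm (hmono.leftLim_le le_rfl) (by linarith)

lemma band_mem_slices {d : ℕ} {s t : ℝ} (hs : s ∈ Set.Icc (-1 : ℝ) 1)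
    (ht : t ∈ Set.Icc (-1 : ℝ) 1) :
    {y : Sph d | (y : EuclideanSpace ℝ (Fin (d + 1))) 0 ∈ Set.Ioo s t} ∈ slices d := by
  let e : Sph d := ⟨EuclideanSpace.single 0 1, by simp⟩
  refine ⟨e, -e, s, hs, -t, ⟨by linarith [ht.2], by linarith [ht.1]⟩, ?_⟩
  ext y
  simp [cap, e, EuclideanSpace.inner_single_left]

/-- The sphere contains `N` pairwise disjoint slices of measure `1 / N`. -/
lemma exists_disjoint_slices {d : ℕ} [IsProbabilityMeasure (uniformMeasure d)] (hd : 1 ≤ d)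
    (N : ℕ) (hN : 0 < N) :
    ∃ A : Fin N → Set (Sph d), (∀ j, A j ∈ slices d) ∧
      (∀ j, (uniformMeasure d).real (A j) = 1 / N) ∧ Pairwise (Function.onFun Disjoint A) := by
  let f : Sph d → ℝ := fun y => (y : EuclideanSpace ℝ (Fin (d + 1))) 0
  have hf : Measurable f := by fun_prop
  let ν := (uniformMeasure d).map f
  have : IsProbabilityMeasure ν := Measure.isProbabilityMeasure_map hf.aemeasurable
  have hν : ∀ t, ν {t} = 0 := fun t => by
    rw [Measure.map_apply hf (measurableSet_singleton t)]
    exact uniformMeasure_coord_eq hd t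
  have : NullSingletonClass ν := ⟨hν⟩
  have habs : ∀ y, |f y| ≤ 1 := fun y => by
    have h := PiLp.norm_apply_le (y : EuclideanSpace ℝ (Fin (d + 1))) 0
    rwa [norm_eq_of_mem_sphere] at h
  have h0 : cdf ν (-1) = 0 := by
    rw [cdf_eq_real, measureReal_eq_zero_iff, ← Set.Iio_union_right,
      measure_union_null_iff]
    refine ⟨?_, hν _⟩
    rw [Measure.map_apply hf measurableSet_Iio, show f ⁻¹' Set.Iio (-1) = ∅ from ?_, measure_empty]
    refine Set.eq_empty_of_forall_notMem fun y hy => ?_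
    exact absurd (abs_le.1 (habs y)).1 (not_le.2 hy)
  have h1 : cdf ν 1 = 1 := by
    rw [cdf_eq_real, map_measureReal_apply hf measurableSet_Iic,
      show f ⁻¹' Set.Iic 1 = Set.univ from ?_, probReal_univ]
    exact Set.eq_univ_of_forall fun y => (abs_le.1 (habs y)).2
  have hN' : (0 : ℝ) < N := Nat.cast_pos.2 hN
  -- Stated for all `j`, with a dummy value beyond `N`, so that `t` becomes a function on `ℕ` and `t
  -- (j + 1)` needs no bound.
  have hquant : ∀ j : ℕ, ∃ t ∈ Set.Icc (-1 : ℝ) 1, j ≤ N → cdf ν t = j / N := by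
    intro j
    by_cases hj : j ≤ N
    · have hmem : (j : ℝ) / N ∈ Set.Icc (cdf ν (-1)) (cdf ν 1) := by
        rw [h0, h1]
        exact ⟨by positivity, (div_le_one hN').2 (by exact_mod_cast hj)⟩
      obtain ⟨t, ht, h⟩ := intermediate_value_Icc (by norm_num : (-1 : ℝ) ≤ 1)
        (continuous_cdf ν hν).continuousOn hmem
      exact ⟨t, ht, fun _ => h⟩
    · exact ⟨0, by norm_num, fun h => absurd h hj⟩
  choose t ht hcdf using hquant
  have hle : ∀ i j : ℕ, i < j → j ≤ N → t i ≤ t j := by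
    intro i j hij hj
    by_contra! h
    have := monotone_cdf ν h.le
    rw [hcdf i (hij.le.trans hj), hcdf j hj, div_le_div_iff_of_pos_right hN', Nat.cast_le] at this
    omega
  refine ⟨fun j => {y | f y ∈ Set.Ioo (t j) (t (j + 1))}, fun j => band_mem_slices (ht _) (ht _),
    fun j => ?_, ?_⟩
  · have h : (uniformMeasure d).real {y | f y ∈ Set.Ioo (t j) (t (j + 1))} =
        ν.real (Set.Ioo (t j) (t (j + 1))) := (map_measureReal_apply hf measurableSet_Ioo).symm
    have h' : ν (Set.Ioo (t j) (t (j + 1))) = ENNReal.ofReal (1 / N) := by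
      rw [measure_congr Ioo_ae_eq_Ioc]
      conv_lhs => rw [← measure_cdf ν]
      rw [(cdf ν).measure_Ioc, hcdf _ j.2, hcdf _ j.2.le]
      congr 1
      push_cast
      ring
    rw [h, measureReal_def, h', ENNReal.toReal_ofReal (by positivity)]
  · have hlt : ∀ i j : Fin N, i < j → Disjoint {y | f y ∈ Set.Ioo (t i) (t (i + 1))}
        {y | f y ∈ Set.Ioo (t j) (t (j + 1))} := by
      intro i j hij
      refine Set.disjoint_left.2 fun y hy hy' => ?_
      have h₁ : t (i + 1) ≤ t j := by
        rcases (Nat.succ_le_of_lt hij).eq_or_lt with h | h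
        · exact (congrArg t h).le
        · exact hle _ _ h j.2.le
      exact absurd (hy.2.trans_le h₁) (not_lt.2 hy'.1.le)
    intro i j hij
    rcases lt_or_gt_of_ne hij with h | h
    · exact hlt i j h
    · exact (hlt j i h).symm

/-! ### The lower bound -/

open Classical in
/-- Second-moment lower bound for the probability that `n` independent points miss one of `N`
disjoint sets of measure `p`. -/
lemma le_integral_of_missed {S : Type*} [MeasurableSpace S] (π : Measure S)
    [IsProbabilityMeasure π] {n N : ℕ} {p : ℝ} (A : Fin N → Set S) (hA : ∀ j, MeasurableSet (A j))
    (hp : ∀ j, π.real (A j) = p) (hdisj : Pairwise (Function.onFun Disjoint A))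
    {D : (Fin n → S) → ℝ} (hD : Integrable D (Measure.pi fun _ => π)) (hD₀ : ∀ x, 0 ≤ D x)
    (hDp : ∀ x j, (∀ i, x i ∉ A j) → p ≤ D x) (hp₀ : 0 ≤ p) (hp₁ : p ≤ 1) :
    p * (N * (1 - p) ^ n / (1 + N * (1 - p) ^ n)) ≤ ∫ x, D x ∂(Measure.pi fun _ => π) := by
  set ρ : Measure (Fin n → S) := Measure.pi fun _ => π
  set q := (1 - p) ^ n with hq
  have hq₀ : 0 ≤ q := pow_nonneg (sub_nonneg.2 hp₁) n
  have hmiss : ∀ C : Set S, ρ.real {x | ∀ i, x i ∉ C} = π.real Cᶜ ^ n := by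
    intro C
    have : {x : Fin n → S | ∀ i, x i ∉ C} = Set.univ.pi fun _ => Cᶜ := by ext x; simp
    rw [this, measureReal_def, Measure.pi_pi]
    simp [measureReal_def]
  let E : Fin N → Set (Fin n → S) := fun j => {x | ∀ i, x i ∉ A j}
  have hE : ∀ j, MeasurableSet (E j) := fun j => measurableSet_forall_notMem (hA j)
  have hE1 : ∀ j, ρ.real (E j) = q := fun j => by
    rw [hmiss, probReal_compl_eq_one_sub (hA j), hp]
  -- Off the diagonal, disjointness gives negative correlation: `1 - 2 p ≤ (1 - p) ^ 2`.
  have hE2 : ∀ j k, ρ.real (E j ∩ E k) ≤ (if j = k then q else 0) + q ^ 2 := by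
    intro j k
    split_ifs with h
    · subst h
      rw [Set.inter_self, hE1]
      nlinarith
    · have hEE : E j ∩ E k = {x | ∀ i, x i ∉ A j ∪ A k} := by
        ext x
        simp [E, forall_and]
      have hAA : π.real (A j ∪ A k)ᶜ = 1 - 2 * p := by
        rw [probReal_compl_eq_one_sub ((hA j).union (hA k)),
          measureReal_union (hdisj h) (hA k), hp, hp]
        ring
      have h₀ : 0 ≤ 1 - 2 * p := hAA ▸ measureReal_nonneg
      rw [hEE, hmiss, hAA, zero_add, hq, ← pow_mul, mul_comm n 2, pow_mul]
      exact pow_le_pow_left₀ h₀ (by nlinarith) n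
  let I : Fin N → (Fin n → S) → ℝ := fun j => (E j).indicator 1
  have hI : ∀ j, Integrable (I j) ρ := fun j => (integrable_const 1).indicator (hE j)
  have hII : ∀ j k, I j * I k = (E j ∩ E k).indicator 1 := fun j k =>
    (Set.inter_indicator_one).symm
  have hIIint : ∀ j k, Integrable (I j * I k) ρ := fun j k => by
    rw [hII]
    exact (integrable_const 1).indicator ((hE j).inter (hE k))
  set m := N * q with hm
  have hm₀ : 0 ≤ m := by positivity
  have hZ : ∫ x, ∑ j, I j x ∂ρ = m := by
    rw [integral_finsetSum _ fun j _ => hI j]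
    simp [I, integral_indicator_one (hE _), hE1, hm]
  have hZ2 : ∫ x, ∑ j, ∑ k, (I j * I k) x ∂ρ ≤ m + m ^ 2 := by
    rw [integral_finsetSum _ fun j _ => integrable_finsetSum _ fun k _ => hIIint j k]
    simp_rw [integral_finsetSum _ fun k _ => hIIint _ k, hII,
      integral_indicator_one ((hE _).inter (hE _))]
    calc ∑ j, ∑ k, ρ.real (E j ∩ E k)
        ≤ ∑ j : Fin N, ∑ k : Fin N, ((if j = k then q else 0) + q ^ 2) :=
          Finset.sum_le_sum fun j _ => Finset.sum_le_sum fun k _ => hE2 j k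
      _ = m + m ^ 2 := by
          simp [Finset.sum_add_distrib, hm]
          ring
  -- With `Z` the number of missed sets, the indicator of `Z > 0` is at least `2 c Z - c ^ 2 Z ^ 2`;
  -- this `c` maximises `2 c m - c ^ 2 (m + m ^ 2)`, with value `m / (1 + m)`.
  set c := 1 / (1 + m) with hc
  have hpoint : ∀ x, p * (2 * c * ∑ j, I j x - c ^ 2 * ∑ j, ∑ k, (I j * I k) x) ≤ D x := by
    intro x
    have hsq : ∑ j, ∑ k, (I j * I k) x = (∑ j, I j x) ^ 2 := by
      rw [sq, Finset.sum_mul_sum]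
      rfl
    rw [hsq]
    by_cases h : ∃ j, x ∈ E j
    · obtain ⟨j, hj⟩ := h
      refine le_trans ?_ (hDp x j hj)
      have : 2 * c * ∑ j, I j x - c ^ 2 * (∑ j, I j x) ^ 2 ≤ 1 := by
        nlinarith [sq_nonneg (1 - c * ∑ j, I j x)]
      nlinarith
    · push Not at h
      have : ∑ j, I j x = 0 := Finset.sum_eq_zero fun j _ => Set.indicator_of_notMem (h j) _
      simpa [this] using hD₀ x
  have hsum_integrable : Integrable (fun x => ∑ j, I j x) ρ := integrable_finsetSum _ fun j _ => hI j
  have hsq_integrable : Integrable (fun x => ∑ j, ∑ k, (I j * I k) x) ρ :=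
    integrable_finsetSum _ fun j _ => integrable_finsetSum _ fun k _ => hIIint j k
  have hmono := integral_mono (((hsum_integrable.const_mul (2 * c)).sub
    (hsq_integrable.const_mul (c ^ 2))).const_mul p) hD hpoint
  refine le_trans ?_ hmono
  rw [integral_const_mul, integral_sub' (hsum_integrable.const_mul _) (hsq_integrable.const_mul _),
    integral_const_mul, integral_const_mul, hZ]
  refine mul_le_mul_of_nonneg_left ?_ hp₀
  have h₁ : m / (1 + m) = 2 * c * m - c ^ 2 * (m + m ^ 2) := by
    rw [hc]
    field_simp
    ring
  rw [h₁]
  gcongr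

/-- Choice of the number of disjoint sets in the lower bound. -/
lemma exists_number_of_slices {n : ℕ} (hn : 32 ≤ n) : ∃ N : ℕ, 0 < N ∧
    1 / 9 * (Real.log n / n) ≤
      1 / N * (N * (1 - 1 / N) ^ n / (1 + N * (1 - 1 / N : ℝ) ^ n)) := by
  have hn' : (32 : ℝ) ≤ n := by exact_mod_cast hn
  have hn0 : (0 : ℝ) < n := by linarith
  set L := Real.log n with hL
  have hL0 : 0 < L := Real.log_pos (by linarith)
  have hL4 : 4 * L ≤ n := by
    have h₁ : L = 5 * Real.log 2 + Real.log (n / 32) := by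
      rw [Real.log_div hn0.ne' (by norm_num), show (32 : ℝ) = 2 ^ 5 by norm_num, Real.log_pow]
      push_cast
      ring
    have h₂ := Real.log_le_sub_one_of_pos (show (0 : ℝ) < n / 32 by positivity)
    linarith [Real.log_two_lt_d9]
  have h4 : 4 ≤ n / L := by rwa [le_div_iff₀ hL0]
  -- This size gives `(1 - 1 / N) ^ n ≥ n ^ (-2 / 3)`, so the expected number of missed sets is at
  -- least `(3 / 2) n ^ (1 / 3) / L ≥ 1 / 2`. The bound `n / L ≥ 4` absorbs the rounding.
  set N := ⌊2 * (n / L)⌋₊ with hN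
  have hNle : (N : ℝ) ≤ 2 * (n / L) := Nat.floor_le (by positivity)
  have hNge : 2 * (n / L) - 1 < N := Nat.sub_one_lt_floor _
  have hN1 : 3 / 2 * (n / L) ≤ (N : ℝ) - 1 := by linarith
  have hN0 : (0 : ℝ) < N := by linarith
  refine ⟨N, by exact_mod_cast hN0, ?_⟩
  have hpow : Real.exp (-(2 / 3 * L)) ≤ (1 - 1 / N : ℝ) ^ n := by
    have hbase : Real.exp (-(1 / ((N : ℝ) - 1))) ≤ 1 - 1 / N := by
      have hNpos : (0 : ℝ) < N - 1 := by linarith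
      have h := Real.add_one_le_exp (1 / ((N : ℝ) - 1))
      rw [Real.exp_neg, inv_le_comm₀ (Real.exp_pos _) (by
        rw [sub_pos, div_lt_one hN0]; linarith)]
      refine le_trans (le_of_eq ?_) h
      field_simp
      ring
    refine le_trans ?_ (pow_le_pow_left₀ (Real.exp_pos _).le hbase n)
    rw [← Real.exp_nat_mul]
    gcongr
    have : (n : ℝ) * (1 / (N - 1)) ≤ 2 / 3 * L := by
      rw [mul_one_div, div_le_iff₀ (by linarith)]
      calc (n : ℝ) = 2 / 3 * L * (3 / 2 * (n / L)) := by field_simp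
        _ ≤ 2 / 3 * L * (N - 1) := by gcongr
    linarith
  set m := N * (1 - 1 / N : ℝ) ^ n with hm
  have hmge : 1 / 2 ≤ m := by
    have hexp : L / 3 ≤ Real.exp (1 / 3 * L) := by linarith [Real.add_one_le_exp (1 / 3 * L)]
    have hn_eq : (n : ℝ) = Real.exp (1 / 3 * L) * Real.exp (2 / 3 * L) := by
      rw [← Real.exp_add, ← add_mul]
      norm_num [hL, Real.exp_log hn0]
    calc (1 : ℝ) / 2 = 3 / 2 * (L / 3 / L) := by field_simp
      _ ≤ 3 / 2 * (Real.exp (1 / 3 * L) / L) := by gcongr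
      _ = 3 / 2 * (n / L) * Real.exp (-(2 / 3 * L)) := by
          rw [Real.exp_neg, eq_mul_inv_iff_mul_eq₀ (Real.exp_pos _).ne', mul_assoc,
            div_mul_eq_mul_div (Real.exp _) L, ← hn_eq]
      _ ≤ m := by
          rw [hm]
          gcongr
          linarith
  have hfrac : 2 / 9 ≤ m / (1 + m) := by
    rw [le_div_iff₀ (by linarith)]
    linarith
  calc 1 / 9 * (L / n) = 1 / (2 * (n / L)) * (2 / 9) := by field_simp
    _ ≤ 1 / N * (m / (1 + m)) := by gcongr

theorem le_integral_disp {n d : ℕ} [IsProbabilityMeasure (uniformMeasure d)] (hd : 1 ≤ d)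
    (hn : 32 ≤ n) :
    1 / 9 * (Real.log n / n) ≤
      ∫ x : Fin n → Sph d, disp d (Set.range x) ∂(Measure.pi fun _ => uniformMeasure d) := by
  obtain ⟨N, hN, hle⟩ := exists_number_of_slices hn
  obtain ⟨A, hA, hmeas, hdisj⟩ := exists_disjoint_slices hd N hN
  refine hle.trans (le_integral_of_missed (uniformMeasure d) A
    (fun j => measurableSet_of_mem_slices (hA j)) hmeas hdisj (integrable_disp_range _)
    (fun x => disp_nonneg _) (fun x j hx => ?_) (by positivity) ?_)
  · rw [← hmeas j]
    exact measureReal_le_disp (hA j) (range_inter_eq_empty_iff.2 hx)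
  · rw [div_le_one (by positivity)]
    exact_mod_cast hN

end SphericalDispersion

end

/-! ### Transfer to the random points -/

theorem theoremB {Ω : Type*} [MeasurableSpace Ω] (μ : Measure Ω) [IsProbabilityMeasure μ]
    (n d : ℕ) (hd : 1 ≤ d) (hn : 32 * d ≤ n)
    (X : Fin n → Ω → SphericalDispersion.Sph d)
    (hlaw : ∀ i, HasLaw (X i) (SphericalDispersion.uniformMeasure d) μ)
    (hindep : iIndepFun X μ) :
    Integrable (fun ω => SphericalDispersion.disp d (Set.range fun i => X i ω)) μ ∧
      1 / 9 * (Real.log n / n) ≤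
        ∫ ω, SphericalDispersion.disp d (Set.range fun i => X i ω) ∂μ ∧
      ∫ ω, SphericalDispersion.disp d (Set.range fun i => X i ω) ∂μ ≤
        64 / Real.log 2 * ((d : ℝ) / n) * Real.log (Real.exp 1 * n / (32 * d)) := by
  have hn32 : 32 ≤ n := by omega
  -- That the Hausdorff measure of the sphere normalises properly is read off from `hlaw`: the law
  -- of a random variable under a probability measure has mass one.
  have hprob : IsProbabilityMeasure (SphericalDispersion.uniformMeasure d) :=
    (hlaw ⟨0, by omega⟩).isProbabilityMeasure_iff.1 inferInstance
  have hX := hindep.hasLaw_pi hlaw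
  have hmeas := SphericalDispersion.measurable_disp_range (d := d) n
  have h_integrable := SphericalDispersion.integrable_disp_range
    (Measure.pi fun _ : Fin n => SphericalDispersion.uniformMeasure d)
  have heq := hX.integral_comp hmeas.aestronglyMeasurable
  refine ⟨?_, ?_, ?_⟩
  · rw [← hX.map_eq] at h_integrable
    exact h_integrable.comp_aemeasurable hX.aemeasurable
  · exact (SphericalDispersion.le_integral_disp hd hn32).trans_eq heq.symm
  · exact heq.trans_le (SphericalDispersion.integral_disp_le hd hn)
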